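/- Let $\mathbb{K}$ be $\mathbb{R}$ or $\mathbb{C}$. An $n\times n$ matrix $O$ over $\mathbb{K}$ is of Hadamard type with constant $\beta\ge 1$ if it is orthogonal (unitary when $\mathbb{K}=\mathbb{C}$) and $|O_{i,j}|\le \beta/\sqrt n$ for all $i,j$. For $1\le k\le n$ let $V_k=\{v\in S^{n-1}: v \text{ has at most } k \text{ nonzero coordinates}\}\subset\mathbb{R}^n$. For matrices $U,W$ and $z\in S^{n-1}$ (the unit sphere of $\mathbb{R}^n$) let $D_{Wz}$ be the diagonal matrix with diagonal $Wz$, and define the seminorm $$\|x\|_z=\sqrt n\,\|D_{Wz}U^*x\|_2=\Bigl(n\sum_{\ell=1}^n|\langle W_\ell,z\rangle|^2\,|\langle U^\ell,x\rangle|^2\Bigr)^{1/2},\qquad x\in\mathbb{R}^n,$$ where $(Wz)_\ell=\langle W_\ell,z\rangle$ and $(U^*x)_\ell=\langle U^\ell,x\rangle$, with $W_\ell$ the rows of $W$ and $U^\ell$ the columns of $U$. For a seminorm $p$ let $N(V_k,p,\varepsilon)$ be the smallest cardinality of a subset $C\subseteq V_k$ such that every $x\in V_k$ has some $y\in C$ with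 $p(x-y)\le\varepsilon$. There is an absolute constant $c>0$ such that for all $1\le k\le n$, all $\beta\ge1$, all $U,W$ of Hadamard type with constant $\beta$, all $z\in S^{n-1}$ and all $\varepsilon>0$, the covering number $N(V_k,\|\cdot\|_z,\varepsilon)$ is finite and $$\log N(V_k,\|\cdot\|_z,\varepsilon)\le c\,\beta^2\,\varepsilon^{-2}\,k\log(en/k).$$ Moreover, for the seminorm $p_z(x)=\|D_{Wz}U^*x\|_2$ without the factor $\sqrt n$, $N(V_k,p_z,\varepsilon)$ is finite and $\log N(V_k,p_z,\varepsilon)\le c\,\beta\,\varepsilon^{-2}\,k\log(en/k)$. -/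

import Mathlib

open scoped NNReal Matrix

/-- A matrix `O` of size `n × n` over `𝕜 = ℝ` or `ℂ` is of Hadamard type with constant `β ≥ 1` if
it is orthogonal (for `𝕜 = ℝ`; unitary for `𝕜 = ℂ`) and all its entries are bounded in absolute
value by `β / √n`. -/
def IsHadamardType {𝕜 : Type*} [RCLike 𝕜] {n : ℕ} (β : ℝ) (O : Matrix (Fin n) (Fin n) 𝕜) : Prop :=
  1 ≤ β ∧ O ∈ Matrix.unitaryGroup (Fin n) 𝕜 ∧ ∀ i j, ‖O i j‖ ≤ β / Real.sqrt n

/-- The set `V_k` of `k`-sparse vectors in the Euclidean unit sphere of `ℝⁿ`. -/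
def sparseUnitVectors (n k : ℕ) : Set (EuclideanSpace ℝ (Fin n)) :=
  {v | ‖v‖ = 1 ∧ {i | v i ≠ 0}.ncard ≤ k}

/-- The coordinatewise inclusion of a real vector into `𝕜ⁿ` (the identity when `𝕜 = ℝ`). -/
def coeVec (𝕜 : Type*) [RCLike 𝕜] {n : ℕ} (x : EuclideanSpace ℝ (Fin n)) : Fin n → 𝕜 :=
  fun i => ((x i : ℝ) : 𝕜)

/-- The seminorm `x ↦ ‖D_{Wz} U* x‖₂` on `ℝⁿ`, where `D_{Wz}` is the diagonal matrix with
diagonal `Wz`. -/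
noncomputable def diagNorm {𝕜 : Type*} [RCLike 𝕜] {n : ℕ} (U W : Matrix (Fin n) (Fin n) 𝕜)
    (z : EuclideanSpace ℝ (Fin n)) : Seminorm ℝ (EuclideanSpace ℝ (Fin n)) :=
  Seminorm.of
    (fun x => ‖WithLp.toLp 2 ((Matrix.diagonal (W *ᵥ coeVec 𝕜 z) * Uᴴ) *ᵥ coeVec 𝕜 x)‖)
    (fun x y => by
      have h : coeVec 𝕜 (x + y) = coeVec 𝕜 x + coeVec 𝕜 y := by
        ext i; simp [coeVec]
      rw [h, Matrix.mulVec_add, WithLp.toLp_add]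
      exact norm_add_le _ _)
    (fun a x => by
      have h : coeVec 𝕜 (a • x) = (a : 𝕜) • coeVec 𝕜 x := by
        ext i; simp [coeVec]
      rw [h, Matrix.mulVec_smul, WithLp.toLp_smul, norm_smul, RCLike.norm_ofReal,
        Real.norm_eq_abs])

/-- The normalized ellipsoid (semi)norm `‖x‖_z = √n ‖D_{Wz} U* x‖₂` on `ℝⁿ`. -/
noncomputable def ellipsoidNorm {𝕜 : Type*} [RCLike 𝕜] {n : ℕ} (U W : Matrix (Fin n) (Fin n) 𝕜)
    (z : EuclideanSpace ℝ (Fin n)) : Seminorm ℝ (EuclideanSpace ℝ (Fin n)) :=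
  NNReal.sqrt n • diagNorm U W z

/-- The expanded form `‖x‖_z² = n ∑_ℓ |⟨W_ℓ, z⟩|² |⟨U^ℓ, x⟩|²`, where `W_ℓ` are the rows of `W`
and `U^ℓ` the columns of `U`. -/
theorem ellipsoidNorm_sq {𝕜 : Type*} [RCLike 𝕜] {n : ℕ} (U W : Matrix (Fin n) (Fin n) 𝕜)
    (z x : EuclideanSpace ℝ (Fin n)) :
    ellipsoidNorm U W z x ^ 2 =
      n * ∑ l, ‖∑ j, W l j * (z j : 𝕜)‖ ^ 2 * ‖∑ i, star (U i l) * (x i : 𝕜)‖ ^ 2 := by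
  have h : ellipsoidNorm U W z x = Real.sqrt n *
      ‖WithLp.toLp 2 ((Matrix.diagonal (W *ᵥ coeVec 𝕜 z) * Uᴴ) *ᵥ coeVec 𝕜 x)‖ := by
    have h' : diagNorm U W z x =
      ‖WithLp.toLp 2 ((Matrix.diagonal (W *ᵥ coeVec 𝕜 z) * Uᴴ) *ᵥ coeVec 𝕜 x)‖ := rfl
    simp [ellipsoidNorm, h', NNReal.smul_def]
  rw [h, mul_pow, Real.sq_sqrt (Nat.cast_nonneg n), EuclideanSpace.norm_sq_eq]
  congr 1
  refine Finset.sum_congr rfl fun l _ => ?_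
  change ‖((Matrix.diagonal (W *ᵥ coeVec 𝕜 z) * Uᴴ) *ᵥ coeVec 𝕜 x) l‖ ^ 2 = _
  rw [← Matrix.mulVec_mulVec, Matrix.mulVec_diagonal, norm_mul, mul_pow]
  rfl

/-- The covering number `N(T, p, ε)`: the minimal cardinality of a set `C ⊆ T` such that every
point of `T` is at `p`-distance at most `ε` from some point of `C`. This is the covering
number of `T` for the distance `p (x - y)`. -/
noncomputable def seminormCoveringNumber {E : Type*} [AddCommGroup E] [Module ℝ E]
    (T : Set E) (p : Seminorm ℝ E) (ε : ℝ≥0) : ℕ∞ :=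
  letI := p.toAddGroupSeminorm.toSeminormedAddCommGroup
  Metric.coveringNumber ε T

/-- The covering number written out. -/
theorem seminormCoveringNumber_eq {E : Type*} [AddCommGroup E] [Module ℝ E]
    (T : Set E) (p : Seminorm ℝ E) (ε : ℝ≥0) :
    seminormCoveringNumber T p ε =
      ⨅ (C : Set E) (_ : C ⊆ T) (_ : ∀ x ∈ T, ∃ y ∈ C, p (x - y) ≤ ε), C.encard := by
  let := p.toAddGroupSeminorm.toSeminormedAddCommGroup
  have key : ∀ x y : E, edist x y ≤ (ε : ENNReal) ↔ p (x - y) ≤ ε := fun x y => by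
    rw [edist_nndist, ENNReal.coe_le_coe, ← NNReal.coe_le_coe, coe_nndist, dist_eq_norm]
    rfl
  unfold seminormCoveringNumber Metric.coveringNumber Metric.IsCover SetRel.IsCover
  simp only [Set.mem_ofPred_eq, key]

/-!
Both seminorms have the form `p x = ‖T x‖` with `T` linear into a real Hilbert space. The only
information used about `T` is a bound `r` for `p eᵢ`: one may take `r = β` for `ellipsoidNorm`, by
the entry bounds of `U`, and `r = 1 ≤ β` for `diagNorm`, since `|U i l| ≤ 1` and `‖Wz‖ = 1`.
It then suffices to bound the entropy by `32 (r / ε)² k log (e n / k)`, which is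
`log_seminormCoveringNumber_sparseUnitVectors_le`.

The proof is a volumetric version of Maurey's empirical method. A sparse unit vector `x` has
`‖x‖₁ ≤ √k`, so it is the mean of a random atom `± √k eᵢ` with some law `q` on the `2n` signed
indices, and the average of `m ≈ 8 k r² / ε²` independent atoms is within `ε / 2` of `x` with
probability at least `1 / 2`. Counting all possible averages would give `log n` in place of
`log (e n / k)`. Instead, call a sequence of `m` atoms good for `x` if its average is that close to
`x`. Since the total mass `1` of `q` splits into a part proportional to `|xᵢ|` and a uniform part,
the collision probability `∑ q²` is at most `5 / (2k)`, so by the Cauchy–Schwarz inequality there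
are at least `(2k / 5)ᵐ / 4` good sequences for each `x` (`quarter_le_card_mul_pow`). Points at
`p`-distance more than `ε` have disjoint sets of good sequences, and there are `(2n)ᵐ` sequences
altogether, so an `ε`-separated set has at most `4 (5 n / k)ᵐ` elements
(`card_le_four_mul_pow_of_separated`). When `ε ≥ 2 √k r`, where `m` could not be taken proportional
to `k r² / ε²`, the whole set has diameter at most `ε`.
-/

/-! ### Empirical means in Hilbert space -/

open Finset in
/-- The second moment of a sum of `m` independent copies of a centred random vector `w` with
finitely many values: the cross terms vanish, as in the Hilbert space Pythagoras theorem. -/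
theorem sum_prod_mul_norm_sum_sq {ι H : Type*} [Fintype ι] [NormedAddCommGroup H]
    [InnerProductSpace ℝ H] (q : ι → ℝ) (hq : ∑ i, q i = 1) (w : ι → H)
    (hw : ∑ i, q i • w i = 0) (m : ℕ) :
    ∑ f : Fin m → ι, (∏ j, q (f j)) * ‖∑ j, w (f j)‖ ^ 2 = m * ∑ i, q i * ‖w i‖ ^ 2 := by
  induction m with
  | zero => simp
  | succ m ih =>
    have hP : ∑ f : Fin m → ι, ∏ j, q (f j) = 1 := by
      rw [← Fintype.sum_pow, hq, one_pow]
    rw [← (Fin.consEquiv fun _ => ι).sum_comp, Fintype.sum_prod_type]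
    have key : ∀ (a : ι) (g : Fin m → ι),
        (∏ j, q ((Fin.consEquiv fun _ => ι) (a, g) j)) *
            ‖∑ j, w ((Fin.consEquiv fun _ => ι) (a, g) j)‖ ^ 2 =
          q a * ‖w a‖ ^ 2 * (∏ j, q (g j)) +
            2 * inner ℝ (q a • w a) ((∏ j, q (g j)) • ∑ j, w (g j)) +
            q a * ((∏ j, q (g j)) * ‖∑ j, w (g j)‖ ^ 2) := by
      intro a g
      simp only [Fin.consEquiv_apply, Fin.prod_univ_succ, Fin.sum_univ_succ, Fin.cons_zero,
        Fin.cons_succ]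
      rw [norm_add_sq_real, real_inner_smul_left, real_inner_smul_right]
      ring
    simp only [key, sum_add_distrib, ← mul_sum, ← inner_sum, ← sum_inner, ← sum_mul, hP, hw, ih,
      hq, inner_zero_left]
    push_cast
    ring

open Finset in
/-- If `x` is the mean of a random vector of norm at most `R` taking the value `v i` with
probability `q i`, then many sequences `f` of length `m` have empirical mean within `ε / 2` of `x`:
a random sequence is good with probability at least `1 / 2`, and by the Cauchy–Schwarz inequality
the set of good sequences cannot be small when the collision probability `∑ i, q i ^ 2` is. -/
theorem quarter_le_card_mul_pow {ι H : Type*} [Fintype ι] [NormedAddCommGroup H]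
    [InnerProductSpace ℝ H] {q : ι → ℝ} (hq0 : ∀ i, 0 ≤ q i) (hq : ∑ i, q i = 1)
    {v : ι → H} {x : H} (hx : ∑ i, q i • v i = x) {R χ ε : ℝ} (hv : ∀ i, ‖v i‖ ≤ R)
    (hχ : ∑ i, q i ^ 2 ≤ χ) {m : ℕ} (hm : 0 < m) (hε : 0 < ε) (hmε : 8 * R ^ 2 ≤ m * ε ^ 2) :
    1 / 4 ≤ (#{f : Fin m → ι | ‖(∑ j, v (f j)) - (m : ℝ) • x‖ ≤ m * (ε / 2)} : ℝ) * χ ^ m := by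
  classical
  set P : (Fin m → ι) → ℝ := fun f => ∏ j, q (f j) with hPdef
  have hP0 : ∀ f, 0 ≤ P f := fun f => prod_nonneg fun j _ => hq0 _
  have hP : ∑ f, P f = 1 := by rw [hPdef, ← Fintype.sum_pow, hq, one_pow]
  have hP2 : ∑ f, P f ^ 2 ≤ χ ^ m := by
    simp only [hPdef, ← prod_pow]
    rw [← Fintype.sum_pow (fun i => q i ^ 2)]
    exact pow_le_pow_left₀ (sum_nonneg fun i _ => sq_nonneg _) hχ m
  have hm' : (0 : ℝ) < m := by exact_mod_cast hm
  have hvar : ∑ i, q i * ‖v i - x‖ ^ 2 ≤ R ^ 2 := by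
    have h1 : ∑ i, q i * ‖v i - x‖ ^ 2 = ∑ i, q i * ‖v i‖ ^ 2 - ‖x‖ ^ 2 := by
      have h : ∀ i, q i * ‖v i - x‖ ^ 2 =
          q i * ‖v i‖ ^ 2 - 2 * inner ℝ (q i • v i) x + q i * ‖x‖ ^ 2 := fun i => by
        rw [norm_sub_sq_real, real_inner_smul_left]; ring
      simp only [h, sum_add_distrib, sum_sub_distrib, ← mul_sum, ← sum_inner, ← sum_mul, hx, hq,
        real_inner_self_eq_norm_sq]
      ring
    have h2 : ∑ i, q i * ‖v i‖ ^ 2 ≤ ∑ i, q i * R ^ 2 := sum_le_sum fun i _ =>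
      mul_le_mul_of_nonneg_left (pow_le_pow_left₀ (norm_nonneg _) (hv i) 2) (hq0 i)
    rw [← sum_mul, hq, one_mul] at h2
    nlinarith [sq_nonneg ‖x‖]
  have hmom : ∑ f, P f * ‖(∑ j, v (f j)) - (m : ℝ) • x‖ ^ 2 ≤ m * R ^ 2 := by
    have h := sum_prod_mul_norm_sum_sq q hq (fun i => v i - x)
      (by simp only [smul_sub, sum_sub_distrib, hx, ← sum_smul, hq, one_smul, sub_self]) m
    simp only [sum_sub_distrib, sum_const, card_univ, Fintype.card_fin] at h
    simp only [Nat.cast_smul_eq_nsmul, hPdef]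
    rw [h]
    exact mul_le_mul_of_nonneg_left hvar hm'.le
  set G : Finset (Fin m → ι) :=
    {f : Fin m → ι | ‖(∑ j, v (f j)) - (m : ℝ) • x‖ ≤ m * (ε / 2)} with hG
  -- Chebyshev's inequality for the sequences outside `G`
  have hbad : ∑ f ∈ Gᶜ, P f ≤ 1 / 2 := by
    have h1 : (∑ f ∈ Gᶜ, P f) * (m * (ε / 2)) ^ 2 ≤ m * R ^ 2 := by
      rw [sum_mul]
      refine le_trans ?_ hmom
      refine le_trans (sum_le_sum (g := fun f => P f * ‖(∑ j, v (f j)) - (m : ℝ) • x‖ ^ 2)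
        fun f hf => ?_) (sum_le_univ_sum_of_nonneg fun f => mul_nonneg (hP0 f) (sq_nonneg _))
      have hf' : m * (ε / 2) < ‖(∑ j, v (f j)) - (m : ℝ) • x‖ := by
        simpa [hG] using hf
      exact mul_le_mul_of_nonneg_left (pow_le_pow_left₀ (by positivity) hf'.le 2) (hP0 f)
    have h2 : (0 : ℝ) < (m * (ε / 2)) ^ 2 := by positivity
    refine le_of_mul_le_mul_right (h1.trans ?_) h2
    nlinarith [mul_le_mul_of_nonneg_left hmε hm'.le]
  have hgood : 1 / 2 ≤ ∑ f ∈ G, P f := by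
    have := sum_add_sum_compl G P
    linarith
  have hcs : (∑ f ∈ G, P f) ^ 2 ≤ #G * ∑ f ∈ G, P f ^ 2 := sq_sum_le_card_mul_sum_sq
  have hle : ∑ f ∈ G, P f ^ 2 ≤ χ ^ m :=
    (sum_le_univ_sum_of_nonneg fun f => sq_nonneg _).trans hP2
  have := mul_le_mul_of_nonneg_left hle (Nat.cast_nonneg (α := ℝ) #G)
  nlinarith

open Finset in
/-- A volumetric form of Maurey's empirical method. An `ε`-separated family of means of the vectors
`v i` has pairwise disjoint sets of good sequences, and each of these sets occupies a fixed share
of all sequences of length `m`. -/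
theorem card_le_four_mul_pow_of_separated {α ι H : Type*} [Fintype ι] [NormedAddCommGroup H]
    [InnerProductSpace ℝ H] (C : Finset α) (y : α → H) {q : α → ι → ℝ} {v : ι → H} {R χ ε : ℝ}
    (hq0 : ∀ a ∈ C, ∀ i, 0 ≤ q a i) (hq : ∀ a ∈ C, ∑ i, q a i = 1)
    (hy : ∀ a ∈ C, ∑ i, q a i • v i = y a) (hv : ∀ i, ‖v i‖ ≤ R)
    (hχ0 : 0 ≤ χ) (hχ : ∀ a ∈ C, ∑ i, q a i ^ 2 ≤ χ) {m : ℕ} (hm : 0 < m) (hε : 0 < ε)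
    (hmε : 8 * R ^ 2 ≤ m * ε ^ 2)
    (hsep : ∀ a ∈ C, ∀ b ∈ C, a ≠ b → ε < ‖y a - y b‖) :
    (#C : ℝ) ≤ 4 * (Fintype.card ι * χ) ^ m := by
  classical
  set G : α → Finset (Fin m → ι) := fun a =>
    {f : Fin m → ι | ‖(∑ j, v (f j)) - (m : ℝ) • y a‖ ≤ m * (ε / 2)} with hG
  have hm' : (0 : ℝ) < m := by exact_mod_cast hm
  have hdisj : (C : Set α).PairwiseDisjoint G := by
    intro a ha b hb hab
    refine disjoint_left.2 fun f hfa hfb => ?_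
    simp only [hG, mem_filter, mem_univ, true_and] at hfa hfb
    have h1 : ‖(m : ℝ) • (y a - y b)‖ ≤ m * (ε / 2) + m * (ε / 2) := by
      have : (m : ℝ) • (y a - y b) =
          ((∑ j, v (f j)) - (m : ℝ) • y b) - ((∑ j, v (f j)) - (m : ℝ) • y a) := by
        rw [smul_sub]; abel
      rw [this]
      exact (norm_sub_le _ _).trans (add_le_add hfb hfa)
    rw [norm_smul, Real.norm_of_nonneg hm'.le] at h1
    nlinarith [mul_lt_mul_of_pos_left (hsep a ha b hb hab) hm']
  have hcard : (∑ a ∈ C, (#(G a) : ℝ)) ≤ (Fintype.card ι : ℝ) ^ m := by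
    have h := card_le_univ (C.biUnion G)
    rw [card_biUnion hdisj, Fintype.card_fun, Fintype.card_fin] at h
    exact_mod_cast h
  have hlow : ∑ a ∈ C, (1 / 4 : ℝ) ≤ ∑ a ∈ C, (#(G a) : ℝ) * χ ^ m := sum_le_sum fun a ha =>
    quarter_le_card_mul_pow (hq0 a ha) (hq a ha) (hy a ha) hv (hχ a ha) hm hε hmε
  rw [← sum_mul, sum_const, nsmul_eq_mul] at hlow
  have := mul_le_mul_of_nonneg_right hcard (pow_nonneg hχ0 m)
  rw [← mul_pow] at this
  linarith

/-! ### Covering and packing for a seminorm -/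

/-- A packing bound for a seminorm gives the same bound for the covering number. -/
theorem seminormCoveringNumber_le_of_separated {E : Type*} [AddCommGroup E] [Module ℝ E]
    (T : Set E) (p : Seminorm ℝ E) (ε : ℝ≥0) (N : ℕ)
    (h : ∀ C : Finset E, (C : Set E) ⊆ T →
      (∀ x ∈ C, ∀ y ∈ C, x ≠ y → (ε : ℝ) < p (x - y)) → C.card ≤ N) :
    seminormCoveringNumber T p ε ≤ N := by
  let := p.toAddGroupSeminorm.toSeminormedAddCommGroup
  have key : ∀ x y : E, (ε : ENNReal) < edist x y ↔ (ε : ℝ) < p (x - y) := fun x y => by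
    rw [edist_nndist, ENNReal.coe_lt_coe, ← NNReal.coe_lt_coe, coe_nndist, dist_eq_norm]
    rfl
  refine (Metric.coveringNumber_le_packingNumber ε T).trans ?_
  refine iSup_le fun C => iSup_le fun hCT => iSup_le fun hC => ?_
  by_contra! hlt
  obtain ⟨D, hDC, hD⟩ := Set.exists_subset_encard_eq (Order.add_one_le_of_lt hlt)
  have hfin : D.Finite := Set.finite_of_encard_eq_coe (k := N + 1) (by simpa using hD)
  have h1 := h hfin.toFinset (by simpa using hDC.trans hCT) (fun x hx y hy hxy =>
    (key x y).1 (hC (hDC (by simpa using hx)) (hDC (by simpa using hy)) hxy))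
  rw [hfin.encard_eq_coe_toFinset_card] at hD
  have : hfin.toFinset.card = N + 1 := by exact_mod_cast hD
  omega

/-! ### Sparse vectors as means of signed coordinate vectors -/

/-- Unit vectors with at most `k` nonzero coordinates lie in `√k` times the `ℓ₁` ball. -/
theorem sum_abs_le_sqrt_of_mem_sparseUnitVectors {n k : ℕ} {x : EuclideanSpace ℝ (Fin n)}
    (hx : x ∈ sparseUnitVectors n k) : ∑ i, |x i| ≤ √k := by
  classical
  obtain ⟨h1, h2⟩ := hx
  have hs : ∑ i, |x i| = ∑ i with x i ≠ 0, |x i| := by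
    rw [Finset.sum_filter]
    exact Finset.sum_congr rfl fun i _ => by by_cases h : x i = 0 <;> simp [h]
  have hc : (Finset.card {i | x i ≠ 0} : ℝ) ≤ k := by
    have : ({i | x i ≠ 0} : Set (Fin n)).ncard = Finset.card {i | x i ≠ 0} := by
      rw [← Set.ncard_coe_finset]; simp
    rw [this] at h2
    exact_mod_cast h2
  have hn : ∑ i, |x i| ^ 2 = 1 := by
    have := EuclideanSpace.real_norm_sq_eq x
    simpa [h1] using this.symm
  refine Real.le_sqrt_of_sq_le ?_
  rw [hs]
  refine sq_sum_le_card_mul_sum_sq.trans ?_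
  have : ∑ i with x i ≠ 0, |x i| ^ 2 ≤ 1 := by
    rw [← hn]
    exact Finset.sum_le_univ_sum_of_nonneg fun i => sq_nonneg _
  calc (Finset.card {i | x i ≠ 0} : ℝ) * ∑ i with x i ≠ 0, |x i| ^ 2
      ≤ k * 1 := mul_le_mul hc this (Finset.sum_nonneg fun i _ => sq_nonneg _) (by positivity)
    _ = k := mul_one _

/-- The vectors `± √k T eᵢ`; the Boolean encodes the sign, with `true` for `+`. -/
noncomputable def signedAtoms {n : ℕ} {H : Type*} [NormedAddCommGroup H] [InnerProductSpace ℝ H]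
    (T : EuclideanSpace ℝ (Fin n) →ₗ[ℝ] H) (k : ℕ) (a : Fin n × Bool) : H :=
  ((if a.2 then 1 else -1) * √k) • T (EuclideanSpace.single a.1 1)

/-- A probability distribution on signed indices under which the vector `± √k eᵢ` has mean `x`.
The mass that `∑ i, |x i| ≤ √k` leaves over is spread uniformly, which contributes nothing to the
mean because the two signs cancel. -/
noncomputable def signedLaw {n : ℕ} (k : ℕ) (x : EuclideanSpace ℝ (Fin n)) (a : Fin n × Bool) : ℝ :=
  (|x a.1| / √k + (1 - (∑ i, |x i|) / √k) / n + (if a.2 then 1 else -1) * (x a.1 / √k)) / 2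

theorem signedLaw_nonneg {n k : ℕ} {x : EuclideanSpace ℝ (Fin n)}
    (hx : x ∈ sparseUnitVectors n k) (a : Fin n × Bool) : 0 ≤ signedLaw k x a := by
  have h1 : 0 ≤ 1 - (∑ i, |x i|) / √k :=
    sub_nonneg.2 (div_le_one_of_le₀ (sum_abs_le_sqrt_of_mem_sparseUnitVectors hx) (by positivity))
  have h2 : 0 ≤ (1 - (∑ i, |x i|) / √k) / n := by positivity
  have h3 : |x a.1 / √k| = |x a.1| / √k := by rw [abs_div, abs_of_nonneg (Real.sqrt_nonneg _)]
  have h4 := neg_abs_le (x a.1 / √k)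
  have h5 := le_abs_self (x a.1 / √k)
  unfold signedLaw
  split_ifs <;> linarith

theorem sum_signedLaw {n k : ℕ} (hn : 0 < n) (x : EuclideanSpace ℝ (Fin n)) :
    ∑ a, signedLaw k x a = 1 := by
  have hn' : (n : ℝ) ≠ 0 := by positivity
  have h : ∀ i, signedLaw k x (i, true) + signedLaw k x (i, false) =
      |x i| / √k + (1 - (∑ i, |x i|) / √k) / n := fun i => by
    simp only [signedLaw, if_true, Bool.false_eq_true, if_false]; ring
  rw [Fintype.sum_prod_type]
  simp only [Fintype.sum_bool, h, Finset.sum_add_distrib, ← Finset.sum_div, Finset.sum_const,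
    Finset.card_univ, Fintype.card_fin, nsmul_eq_mul]
  field_simp
  ring

theorem sum_signedLaw_smul_signedAtoms {n k : ℕ} (hk : 0 < k) {H : Type*} [NormedAddCommGroup H]
    [InnerProductSpace ℝ H] (T : EuclideanSpace ℝ (Fin n) →ₗ[ℝ] H)
    (x : EuclideanSpace ℝ (Fin n)) : ∑ a, signedLaw k x a • signedAtoms T k a = T x := by
  have hk' : √(k : ℝ) ≠ 0 := by positivity
  have h : ∀ i, signedLaw k x (i, true) • signedAtoms T k (i, true) +
      signedLaw k x (i, false) • signedAtoms T k (i, false) =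
      T (x i • EuclideanSpace.single i (1 : ℝ)) := fun i => by
    simp only [signedLaw, signedAtoms, if_true, Bool.false_eq_true, if_false, smul_smul,
      ← add_smul, map_smul]
    congr 1
    field_simp
    ring
  rw [Fintype.sum_prod_type]
  simp only [Fintype.sum_bool, h, ← map_sum]
  congr 1
  ext j
  simp [Finset.sum_apply, Pi.single_apply]

/-- The collision probability of `signedLaw` is of order `1 / k` because `‖x‖ = 1`: the law has
density at most of order `|xᵢ| / √k + 1 / n`. -/
theorem sum_signedLaw_sq_le {n k : ℕ} (hk : 0 < k) (hkn : k ≤ n) {x : EuclideanSpace ℝ (Fin n)}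
    (hx : x ∈ sparseUnitVectors n k) : ∑ a, signedLaw k x a ^ 2 ≤ 5 / (2 * k) := by
  have hk' : (0 : ℝ) < k := by exact_mod_cast hk
  have hkn' : (k : ℝ) ≤ n := by exact_mod_cast hkn
  have hn' : (0 : ℝ) < n := hk'.trans_le hkn'
  set t := 1 - (∑ i, |x i|) / √k with ht
  have ht0 : 0 ≤ t :=
    sub_nonneg.2 (div_le_one_of_le₀ (sum_abs_le_sqrt_of_mem_sparseUnitVectors hx) (by positivity))
  have ht1 : t ≤ 1 := by
    have : 0 ≤ (∑ i, |x i|) / √k := by positivity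
    linarith
  have hsq : √(k : ℝ) ^ 2 = k := Real.sq_sqrt hk'.le
  have h : ∀ i, signedLaw k x (i, true) ^ 2 + signedLaw k x (i, false) ^ 2 ≤
      3 / (2 * k) * x i ^ 2 + 1 / (n * n) := fun i => by
    have e : signedLaw k x (i, true) ^ 2 + signedLaw k x (i, false) ^ 2 =
        ((|x i| / √k + t / n) ^ 2 + (x i / √k) ^ 2) / 2 := by
      simp only [signedLaw, if_true, Bool.false_eq_true, if_false, ← ht]; ring
    have e1 : (|x i| / √k) ^ 2 = x i ^ 2 / k := by rw [div_pow, sq_abs, hsq]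
    have e2 : (x i / √k) ^ 2 = x i ^ 2 / k := by rw [div_pow, hsq]
    have e3 : (t / n) ^ 2 ≤ 1 / (n * n) := by
      rw [div_pow, ← sq]
      gcongr
      exact pow_le_one₀ ht0 ht1
    have e4 := add_sq_le (a := |x i| / √k) (b := t / n)
    have e5 : 3 / (2 * k) * x i ^ 2 = 3 / 2 * (x i ^ 2 / k) := by field_simp
    rw [e, e5]
    linarith
  have hn : ∑ i, x i ^ 2 = 1 := by
    have := EuclideanSpace.real_norm_sq_eq x
    rw [hx.1] at this
    simpa using this.symm
  rw [Fintype.sum_prod_type]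
  simp only [Fintype.sum_bool]
  refine (Finset.sum_le_sum fun i _ => h i).trans ?_
  rw [Finset.sum_add_distrib, ← Finset.mul_sum, hn, Finset.sum_const, Finset.card_univ,
    Fintype.card_fin, nsmul_eq_mul]
  have e6 : (n : ℝ) * (1 / (n * n)) = 1 / n := by field_simp
  have e7 : 1 / (n : ℝ) ≤ 1 / k := one_div_le_one_div_of_le hk' hkn'
  have e8 : 5 / (2 * (k : ℝ)) = 3 / (2 * k) * 1 + 1 / k := by field_simp; norm_num
  rw [e6, e8]
  linarith

theorem norm_signedAtoms_le {n k : ℕ} {H : Type*} [NormedAddCommGroup H] [InnerProductSpace ℝ H]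
    (T : EuclideanSpace ℝ (Fin n) →ₗ[ℝ] H) {r : ℝ}
    (hr : ∀ i, ‖T (EuclideanSpace.single i 1)‖ ≤ r) (a : Fin n × Bool) :
    ‖signedAtoms T k a‖ ≤ √k * r := by
  have h : |((if a.2 then 1 else -1) * √k : ℝ)| = √k := by
    rw [abs_mul, abs_of_nonneg (Real.sqrt_nonneg _)]
    split_ifs <;> simp
  rw [signedAtoms, norm_smul, Real.norm_eq_abs, h]
  exact mul_le_mul_of_nonneg_left (hr _) (Real.sqrt_nonneg _)

/-- A linear map into a Hilbert space that sends the unit coordinate vectors into the ball of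
radius `r` maps the sparse unit vectors into the ball of radius `√k * r`. -/
theorem norm_map_le_of_mem_sparseUnitVectors {n k : ℕ} (hk : 0 < k) (hkn : k ≤ n) {H : Type*}
    [NormedAddCommGroup H] [InnerProductSpace ℝ H] (T : EuclideanSpace ℝ (Fin n) →ₗ[ℝ] H) {r : ℝ}
    (hr : ∀ i, ‖T (EuclideanSpace.single i 1)‖ ≤ r) {x : EuclideanSpace ℝ (Fin n)}
    (hx : x ∈ sparseUnitVectors n k) : ‖T x‖ ≤ √k * r := by
  rw [← sum_signedLaw_smul_signedAtoms hk T x]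
  refine (norm_sum_le _ _).trans ?_
  calc ∑ a, ‖signedLaw k x a • signedAtoms T k a‖ ≤ ∑ a, signedLaw k x a * (√k * r) :=
        Finset.sum_le_sum fun a _ => by
          rw [norm_smul, Real.norm_of_nonneg (signedLaw_nonneg hx a)]
          exact mul_le_mul_of_nonneg_left (norm_signedAtoms_le T hr a) (signedLaw_nonneg hx a)
    _ = √k * r := by rw [← Finset.sum_mul, sum_signedLaw (hk.trans_le hkn), one_mul]

/-! ### Entropy of the sparse unit vectors -/

/-- The entropy of the sparse unit vectors for a Hilbertian seminorm `x ↦ ‖T x‖`, in terms of its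
size `r` on the coordinate vectors. -/
theorem log_seminormCoveringNumber_sparseUnitVectors_le {n k : ℕ} (hk : 0 < k) (hkn : k ≤ n)
    {H : Type*} [NormedAddCommGroup H] [InnerProductSpace ℝ H]
    (T : EuclideanSpace ℝ (Fin n) →ₗ[ℝ] H) (p : Seminorm ℝ (EuclideanSpace ℝ (Fin n)))
    (hp : ∀ x, p x = ‖T x‖) {r : ℝ} (hr : ∀ i, p (EuclideanSpace.single i 1) ≤ r)
    {ε : ℝ≥0} (hε : 0 < ε) :
    seminormCoveringNumber (sparseUnitVectors n k) p ε ≠ ⊤ ∧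
      Real.log (seminormCoveringNumber (sparseUnitVectors n k) p ε).toNat ≤
        32 * r ^ 2 * ((ε : ℝ) ^ 2)⁻¹ * (k * Real.log (Real.exp 1 * n / k)) := by
  have hk' : (0 : ℝ) < k := by exact_mod_cast hk
  have hkn' : (k : ℝ) ≤ n := by exact_mod_cast hkn
  have hn' : (0 : ℝ) < n := hk'.trans_le hkn'
  have hε' : (0 : ℝ) < ε := hε
  have hr0 : 0 ≤ r := (apply_nonneg p _).trans (hr ⟨0, hk.trans_le hkn⟩)
  have hrT : ∀ i, ‖T (EuclideanSpace.single i 1)‖ ≤ r := fun i => hp _ ▸ hr i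
  set L := Real.log (Real.exp 1 * n / k) with hL
  have hLeq : L = 1 + Real.log (n / k) := by
    rw [hL, mul_div_assoc, Real.log_mul (Real.exp_ne_zero _) (by positivity), Real.log_exp]
  have hlog0 : 0 ≤ Real.log (n / k) := Real.log_nonneg ((one_le_div hk').2 hkn')
  have hL1 : 1 ≤ L := by linarith
  set A := k * r ^ 2 / (ε : ℝ) ^ 2 with hA
  have hA0 : 0 ≤ A := by positivity
  have hgoal : 32 * r ^ 2 * ((ε : ℝ) ^ 2)⁻¹ * (k * L) = 32 * A * L := by
    rw [hA]; field_simp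
  -- it suffices to bound the cardinality of separated sets by a real number `B` with small logarithm
  have hred : ∀ B : ℝ, 0 < B → Real.log B ≤ 32 * A * L → (∀ C : Finset (EuclideanSpace ℝ (Fin n)),
      (C : Set _) ⊆ sparseUnitVectors n k →
      (∀ x ∈ C, ∀ y ∈ C, x ≠ y → (ε : ℝ) < p (x - y)) → (C.card : ℝ) ≤ B) →
      seminormCoveringNumber (sparseUnitVectors n k) p ε ≠ ⊤ ∧
      Real.log (seminormCoveringNumber (sparseUnitVectors n k) p ε).toNat ≤ 32 * A * L := by
    intro B hB hlogB hC
    have hle := seminormCoveringNumber_le_of_separated (sparseUnitVectors n k) p ε ⌊B⌋₊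
      fun C h1 h2 => Nat.le_floor (hC C h1 h2)
    have htop : seminormCoveringNumber (sparseUnitVectors n k) p ε ≠ ⊤ :=
      ne_top_of_le_ne_top (ENat.natCast_ne_top _) hle
    refine ⟨htop, ?_⟩
    have hnat : (seminormCoveringNumber (sparseUnitVectors n k) p ε).toNat ≤ ⌊B⌋₊ :=
      ENat.toNat_le_of_le_natCast hle
    rcases Nat.eq_zero_or_pos (seminormCoveringNumber (sparseUnitVectors n k) p ε).toNat with h0 | h0
    · rw [h0, Nat.cast_zero, Real.log_zero]
      positivity
    · refine le_trans (Real.log_le_log (by exact_mod_cast h0) ?_) hlogB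
      exact (Nat.cast_le.2 hnat).trans (Nat.floor_le hB.le)
  rw [hgoal]
  by_cases hcase : 2 * (√k * r) ≤ ε
  · -- the set has diameter at most `ε`
    refine hred 1 one_pos (by rw [Real.log_one]; positivity) fun C hC hsep => ?_
    have : C.card ≤ 1 := Finset.card_le_one.2 fun x hx y hy => by
      by_contra hxy
      have h1 := hsep x hx y hy hxy
      rw [hp, map_sub] at h1
      have h2 := norm_sub_le (T x) (T y)
      have h3 := norm_map_le_of_mem_sparseUnitVectors hk hkn T hrT (hC hx)
      have h4 := norm_map_le_of_mem_sparseUnitVectors hk hkn T hrT (hC hy)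
      linarith
    exact_mod_cast this
  · have hR2 : (√k * r) ^ 2 = k * r ^ 2 := by rw [mul_pow, Real.sq_sqrt hk'.le]
    have hA4 : 1 / 4 ≤ A := by
      rw [hA, le_div_iff₀ (by positivity), ← hR2]
      nlinarith
    -- the least `m` for which Chebyshev's inequality applies; `1 / 4 ≤ A` absorbs the rounding
    set m := ⌈8 * A⌉₊
    have hm1 : 8 * A ≤ m := Nat.le_ceil _
    have hm2 : (m : ℝ) ≤ 8 * A + 1 := (Nat.ceil_lt_add_one (by positivity)).le
    have hm0 : 0 < m := Nat.ceil_pos.2 (by linarith)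
    have hlog4 : Real.log 4 ≤ 2 := by
      have : Real.log 4 = 2 * Real.log 2 := by
        rw [← Real.log_rpow (by norm_num)]; norm_num
      linarith [Real.log_two_lt_d9]
    have hlog5 : Real.log 5 ≤ 2 := by
      rw [Real.log_le_iff_le_exp (by norm_num)]
      have h := Real.exp_one_gt_d9
      have : Real.exp 2 = Real.exp 1 * Real.exp 1 := by rw [← Real.exp_add]; norm_num
      nlinarith
    refine hred (4 * (5 * (n / k)) ^ m) (by positivity) ?_ fun C hC hsep => ?_
    · rw [Real.log_mul (by norm_num) (by positivity), Real.log_pow,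
        Real.log_mul (by norm_num) (by positivity)]
      have h1 : Real.log 5 + Real.log (n / k) ≤ 2 * L := by linarith
      have h2 : m * (Real.log 5 + Real.log (n / k)) ≤ (8 * A + 1) * (2 * L) :=
        mul_le_mul hm2 h1 (add_nonneg (Real.log_nonneg (by norm_num)) hlog0) (by positivity)
      nlinarith [mul_le_mul hA4 hL1 zero_le_one hA0, mul_le_mul_of_nonneg_right hA4
        (zero_le_one.trans hL1)]
    · have h := card_le_four_mul_pow_of_separated C T (q := signedLaw k) (v := signedAtoms T k)
        (R := √k * r) (χ := 5 / (2 * k)) (m := m)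
        (fun x hx => signedLaw_nonneg (hC hx)) (fun x _ => sum_signedLaw (hk.trans_le hkn) x)
        (fun x _ => sum_signedLaw_smul_signedAtoms hk T x) (norm_signedAtoms_le T hrT)
        (by positivity) (fun x hx => sum_signedLaw_sq_le hk hkn (hC hx)) hm0 hε' (by
          rw [hR2]
          have : (k : ℝ) * r ^ 2 = A * (ε : ℝ) ^ 2 := by rw [hA]; field_simp
          rw [this]
          nlinarith [mul_le_mul_of_nonneg_right hm1 (sq_nonneg (ε : ℝ))])
        (fun x hx y hy hxy => by rw [← map_sub, ← hp]; exact hsep x hx y hy hxy)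
      refine h.trans (le_of_eq ?_)
      congr 2
      simp only [Fintype.card_prod, Fintype.card_fin, Fintype.card_bool]
      push_cast
      field_simp

/-! ### Size of the seminorms on the coordinate vectors -/

theorem sum_norm_sq_mulVec_of_mem_unitaryGroup {𝕜 : Type*} [RCLike 𝕜] {n : ℕ}
    {W : Matrix (Fin n) (Fin n) 𝕜} (hW : W ∈ Matrix.unitaryGroup (Fin n) 𝕜) (x : Fin n → 𝕜) :
    ∑ l, ‖(W *ᵥ x) l‖ ^ 2 = ∑ l, ‖x l‖ ^ 2 := by
  have key : ∀ y : Fin n → 𝕜, ((∑ l, ‖y l‖ ^ 2 : ℝ) : 𝕜) = star y ⬝ᵥ y := fun y => by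
    simp [dotProduct, RCLike.conj_mul]
  have h : star (W *ᵥ x) ⬝ᵥ (W *ᵥ x) = star x ⬝ᵥ x := by
    rw [Matrix.star_mulVec, ← Matrix.dotProduct_mulVec, Matrix.mulVec_mulVec,
      ← Matrix.star_eq_conjTranspose, Matrix.mem_unitaryGroup_iff'.1 hW, Matrix.one_mulVec]
  rw [← key, ← key] at h
  exact_mod_cast h

theorem sum_norm_sq_coeVec {𝕜 : Type*} [RCLike 𝕜] {n : ℕ} (x : EuclideanSpace ℝ (Fin n)) :
    ∑ l, ‖coeVec 𝕜 x l‖ ^ 2 = ‖x‖ ^ 2 := by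
  simp [coeVec, EuclideanSpace.real_norm_sq_eq]

theorem sum_norm_sq_mulVec_coeVec {𝕜 : Type*} [RCLike 𝕜] {n : ℕ} {W : Matrix (Fin n) (Fin n) 𝕜}
    (hW : W ∈ Matrix.unitaryGroup (Fin n) 𝕜) {z : EuclideanSpace ℝ (Fin n)} (hz : ‖z‖ = 1) :
    ∑ l, ‖(W *ᵥ coeVec 𝕜 z) l‖ ^ 2 = 1 := by
  rw [sum_norm_sq_mulVec_of_mem_unitaryGroup hW, sum_norm_sq_coeVec, hz, one_pow]

theorem diagNorm_single_sq {𝕜 : Type*} [RCLike 𝕜] {n : ℕ} (U W : Matrix (Fin n) (Fin n) 𝕜)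
    (z : EuclideanSpace ℝ (Fin n)) (i : Fin n) :
    diagNorm U W z (EuclideanSpace.single i 1) ^ 2 =
      ∑ l, ‖(W *ᵥ coeVec 𝕜 z) l‖ ^ 2 * ‖U i l‖ ^ 2 := by
  have h : diagNorm U W z (EuclideanSpace.single i 1) =
    ‖WithLp.toLp 2 ((Matrix.diagonal (W *ᵥ coeVec 𝕜 z) * Uᴴ) *ᵥ
      coeVec 𝕜 (EuclideanSpace.single i 1))‖ := rfl
  have hs : coeVec 𝕜 (EuclideanSpace.single i (1 : ℝ)) = Pi.single i 1 := by
    ext j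
    by_cases hj : j = i <;> simp [coeVec, hj]
  rw [h, hs, EuclideanSpace.norm_sq_eq]
  refine Finset.sum_congr rfl fun l _ => ?_
  simp [Matrix.diagonal_mul, mul_pow]

theorem ellipsoidNorm_eq {𝕜 : Type*} [RCLike 𝕜] {n : ℕ} (U W : Matrix (Fin n) (Fin n) 𝕜)
    (z x : EuclideanSpace ℝ (Fin n)) : ellipsoidNorm U W z x = √n * diagNorm U W z x := by
  simp [ellipsoidNorm, NNReal.smul_def]

theorem ellipsoidNorm_single_le {𝕜 : Type*} [RCLike 𝕜] {n : ℕ} {β : ℝ}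
    {U W : Matrix (Fin n) (Fin n) 𝕜} (hU : IsHadamardType β U)
    (hW : W ∈ Matrix.unitaryGroup (Fin n) 𝕜) {z : EuclideanSpace ℝ (Fin n)} (hz : ‖z‖ = 1)
    (i : Fin n) : ellipsoidNorm U W z (EuclideanSpace.single i 1) ≤ β := by
  have hβ : 0 ≤ β := zero_le_one.trans hU.1
  have hn : (0 : ℝ) < n := by exact_mod_cast i.pos
  refine abs_le_of_sq_le_sq' ?_ hβ |>.2
  rw [ellipsoidNorm_eq, mul_pow, Real.sq_sqrt hn.le, diagNorm_single_sq]
  calc (n : ℝ) * ∑ l, ‖(W *ᵥ coeVec 𝕜 z) l‖ ^ 2 * ‖U i l‖ ^ 2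
      ≤ n * ∑ l, ‖(W *ᵥ coeVec 𝕜 z) l‖ ^ 2 * (β / √n) ^ 2 := by
        gcongr with l _
        exact hU.2.2 i l
    _ = β ^ 2 := by
        rw [← Finset.sum_mul, sum_norm_sq_mulVec_coeVec hW hz, div_pow, Real.sq_sqrt hn.le]
        field_simp

theorem diagNorm_single_le_one {𝕜 : Type*} [RCLike 𝕜] {n : ℕ} {U W : Matrix (Fin n) (Fin n) 𝕜}
    (hU : U ∈ Matrix.unitaryGroup (Fin n) 𝕜) (hW : W ∈ Matrix.unitaryGroup (Fin n) 𝕜)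
    {z : EuclideanSpace ℝ (Fin n)} (hz : ‖z‖ = 1) (i : Fin n) :
    diagNorm U W z (EuclideanSpace.single i 1) ≤ 1 := by
  refine abs_le_of_sq_le_sq' ?_ zero_le_one |>.2
  rw [diagNorm_single_sq, one_pow, ← sum_norm_sq_mulVec_coeVec hW hz]
  refine Finset.sum_le_sum fun l _ => mul_le_of_le_one_right (sq_nonneg _) ?_
  exact pow_le_one₀ (norm_nonneg _) (entry_norm_bound_of_unitary hU i l)

/-- `diagNorm` is a Hilbertian seminorm: it is the norm of the image under a linear map into a real
Hilbert space, namely `𝕜ⁿ` with the real part of its inner product. -/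
theorem exists_linearMap_diagNorm.{u} {𝕜 : Type u} [RCLike 𝕜] {n : ℕ} (U W : Matrix (Fin n) (Fin n) 𝕜)
    (z : EuclideanSpace ℝ (Fin n)) :
    ∃ (H : Type u) (_ : NormedAddCommGroup H) (_ : InnerProductSpace ℝ H)
      (T : EuclideanSpace ℝ (Fin n) →ₗ[ℝ] H), ∀ x, diagNorm U W z x = ‖T x‖ := by
  set M := Matrix.diagonal (W *ᵥ coeVec 𝕜 z) * Uᴴ
  have hadd : ∀ x y, WithLp.toLp 2 (M *ᵥ coeVec 𝕜 (x + y)) =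
      WithLp.toLp 2 (M *ᵥ coeVec 𝕜 x) + WithLp.toLp 2 (M *ᵥ coeVec 𝕜 y) := fun x y => by
    have h : coeVec 𝕜 (x + y) = coeVec 𝕜 x + coeVec 𝕜 y := by
      ext i; simp [coeVec]
    rw [h, Matrix.mulVec_add, WithLp.toLp_add]
  have hsmul : ∀ (a : ℝ) (x), WithLp.toLp 2 (M *ᵥ coeVec 𝕜 (a • x)) =
      algebraMap ℝ 𝕜 a • WithLp.toLp 2 (M *ᵥ coeVec 𝕜 x) := fun a x => by
    have h : coeVec 𝕜 (a • x) = algebraMap ℝ 𝕜 a • coeVec 𝕜 x := by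
      ext i; simp [coeVec]
    rw [h, Matrix.mulVec_smul, WithLp.toLp_smul]
  let inst := InnerProductSpace.rclikeToReal 𝕜 (EuclideanSpace 𝕜 (Fin n))
  exact ⟨EuclideanSpace 𝕜 (Fin n), inferInstance, inst,
    @LinearMap.mk _ _ _ _ _ _ _ _ _ _ inst.toModule ⟨_, hadd⟩ hsmul, fun x => rfl⟩

theorem mainTheorem9 :
    ∃ c : ℝ, 0 < c ∧
      ∀ (𝕜 : Type) [RCLike 𝕜] (n k : ℕ), 1 ≤ k → k ≤ n →
      ∀ (β : ℝ) (U W : Matrix (Fin n) (Fin n) 𝕜), IsHadamardType β U → IsHadamardType β W →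
      ∀ z : EuclideanSpace ℝ (Fin n), ‖z‖ = 1 →
      ∀ ε : ℝ≥0, 0 < ε →
        (seminormCoveringNumber (sparseUnitVectors n k) (ellipsoidNorm U W z) ε ≠ ⊤ ∧
          Real.log
              (seminormCoveringNumber (sparseUnitVectors n k) (ellipsoidNorm U W z) ε).toNat ≤
            c * β ^ 2 * ((ε : ℝ) ^ 2)⁻¹ * (k * Real.log (Real.exp 1 * n / k))) ∧
        (seminormCoveringNumber (sparseUnitVectors n k) (diagNorm U W z) ε ≠ ⊤ ∧
          Real.log
              (seminormCoveringNumber (sparseUnitVectors n k) (diagNorm U W z) ε).toNat ≤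
            c * β * ((ε : ℝ) ^ 2)⁻¹ * (k * Real.log (Real.exp 1 * n / k))) := by
  refine ⟨32, by norm_num, fun 𝕜 _ n k hk hkn β U W hU hW z hz ε hε => ?_⟩
  obtain ⟨H, _, _, T, hT⟩ := exists_linearMap_diagNorm U W z
  refine ⟨log_seminormCoveringNumber_sparseUnitVectors_le hk hkn ((√n : ℝ) • T) _ (fun x => ?_)
    (ellipsoidNorm_single_le hU hW.2.1 hz) hε, ?_⟩
  · rw [ellipsoidNorm_eq, hT, LinearMap.smul_apply, norm_smul,
      Real.norm_of_nonneg (Real.sqrt_nonneg _)]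
  · obtain ⟨h1, h2⟩ := log_seminormCoveringNumber_sparseUnitVectors_le hk hkn T _ hT
      (diagNorm_single_le_one hU.2.1 hW.2.1 hz) hε
    refine ⟨h1, h2.trans ?_⟩
    have hk' : (0 : ℝ) < k := by exact_mod_cast hk
    have hkn' : (k : ℝ) ≤ n := by exact_mod_cast hkn
    have hlog : 0 ≤ Real.log (Real.exp 1 * n / k) := by
      refine Real.log_nonneg ((one_le_div hk').2 (hkn'.trans ?_))
      exact le_mul_of_one_le_left (Nat.cast_nonneg n) (Real.one_le_exp zero_le_one)
    rw [one_pow]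
    gcongr
    exact hU.1
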